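/- Let $H$ be a separable complex Hilbert space and let $\mathcal L$ be a commutative subspace lattice on $H$, that is, a family of closed subspaces of $H$ that contains $(0)$ and $H$, is closed under arbitrary intersections and arbitrary closed linear spans, and whose orthogonal projections commute pairwise. Let $\mathrm{alg}\,\mathcal L$ be the algebra of all bounded linear operators on $H$ that leave every member of $\mathcal L$ invariant. Let $m,n,l\ge 0$ be integers with $m+l\ge 1$ and $n+l\ge 1$, and let $\delta:\mathrm{alg}\,\mathcal L\to\mathrm{alg}\,\mathcal L$ be a bounded linear map that is a weak $(m,n,l)$-Jordan centralizer, i.e. for every $A\in\mathrm{alg}\,\mathcal L$ there is $\lambda_A\in\mathbb C$ with $$(m+n+l)\,\delta(A^2)=m\,\delta(A)A+n\,A\delta(A)+l\,A\delta(I)A+\lambda_A I .$$ If $m=n=0$, assume in addition that $\delta$ is a $(0,0,l)$-Jordan centralizer, i.e. that this identity holds with $\lambda_A=0$ for every $A$. Then $\delta$ is a centralizer: $\delta(AB)=\delta(A)B=A\delta(B)$ for all $A,B\in\mathrm{alg}\,\mathcal L$. -/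

import Mathlib

namespace CSL

section Centralizers

variable {K : Type*} [Field K] {𝒜 : Type*} [Ring 𝒜] [Algebra K 𝒜]

/-- `δ (A B) = δ(A) B` for all `A`, `B`. -/
def IsLeftCentralizer (δ : 𝒜 →ₗ[K] 𝒜) : Prop :=
  ∀ A B : 𝒜, δ (A * B) = δ A * B

/-- `δ (A B) = A δ(B)` for all `A`, `B`. -/
def IsRightCentralizer (δ : 𝒜 →ₗ[K] 𝒜) : Prop :=
  ∀ A B : 𝒜, δ (A * B) = A * δ B

/-- A centralizer is both a left and a right centralizer. -/
def IsCentralizer (δ : 𝒜 →ₗ[K] 𝒜) : Prop :=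
  IsLeftCentralizer δ ∧ IsRightCentralizer δ

/-- Weak `(m,n,l)`-Jordan centralizer: `m + n + l ≠ 0`, and
`(m+n+l) δ(A²) - m δ(A) A - n A δ(A) - l A δ(I) A` is a scalar multiple of `I` for every `A`. -/
def IsWeakJordanCentralizer (m n l : ℕ) (δ : 𝒜 →ₗ[K] 𝒜) : Prop :=
  m + n + l ≠ 0 ∧ ∀ A : 𝒜, ∃ c : K,
    (m + n + l) • δ (A * A) - m • (δ A * A) - n • (A * δ A) - l • (A * δ 1 * A) = c • (1 : 𝒜)

/-- `(m,n,l)`-Jordan centralizer: `m + n + l ≠ 0`, and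
`(m+n+l) δ(A²) = m δ(A) A + n A δ(A) + l A δ(I) A` for every `A`. -/
def IsJordanCentralizer (m n l : ℕ) (δ : 𝒜 →ₗ[K] 𝒜) : Prop :=
  m + n + l ≠ 0 ∧ ∀ A : 𝒜,
    (m + n + l) • δ (A * A) = m • (δ A * A) + n • (A * δ A) + l • (A * δ 1 * A)

end Centralizers

section SubspaceLattices

variable {H : Type*} [NormedAddCommGroup H] [InnerProductSpace ℂ H]

/-- A subspace lattice: a family of closed subspaces containing `(0)` and `H` and closed under
arbitrary intersections and arbitrary closed linear spans (`sInf` and `sSup` of Mathlib's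
complete lattice of closed subspaces). -/
structure IsSubspaceLattice (L : Set (ClosedSubmodule ℂ H)) : Prop where
  bot_mem : ⊥ ∈ L
  top_mem : ⊤ ∈ L
  sInf_mem : ∀ S : Set (ClosedSubmodule ℂ H), S ⊆ L → sInf S ∈ L
  sSup_mem : ∀ S : Set (ClosedSubmodule ℂ H), S ⊆ L → sSup S ∈ L

/-- A commutative subspace lattice: a subspace lattice whose orthogonal projections commute
pairwise. -/
structure IsCSL [CompleteSpace H] (L : Set (ClosedSubmodule ℂ H)) : Prop extends
    IsSubspaceLattice L where
  commute : ∀ E ∈ L, ∀ F ∈ L,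
    Commute E.toSubmodule.starProjection F.toSubmodule.starProjection

/-- `alg L`: the algebra of all bounded operators that leave every member of `L` invariant. -/
def alg (L : Set (ClosedSubmodule ℂ H)) : Subalgebra ℂ (H →L[ℂ] H) where
  carrier := {A | ∀ E ∈ L, ∀ x ∈ E, A x ∈ E}
  mul_mem' {A B} hA hB E hE x hx := hA E hE (B x) (hB E hE x hx)
  add_mem' {A B} hA hB E hE x hx := E.toSubmodule.add_mem (hA E hE x hx) (hB E hE x hx)
  algebraMap_mem' c E hE x hx := by
    rw [Algebra.algebraMap_eq_smul_one]
    exact E.toSubmodule.smul_mem c hx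

end SubspaceLattices

end CSL

namespace CSL

section CStar

variable {B : Type*} [CStarAlgebra B]

/-! Put c = δ(1). Comparing the identity at A and A + 1 writes δ(A) as a combination of cA, Ac and
I; substituting this back gives [[c, A], A] ∈ span {A, I}. The core,
`commute_of_double_commutator_mem_span`, deduces that c is central: testing on unitaries shows that
c commutes with the diagonal P' of the algebra, testing on idempotents that it commutes with each
corner pA(1 - p), and unitaries in {c}'' carry this over to A itself. For central c, the same
relations reduce to δ(A) = cA. -/

/-- An element whose commutator with a unitary `u` commutes with `u` commutes with `u`. -/
theorem commute_of_commute_commutator {u x : B} (hu : u ∈ unitary B)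
    (h : Commute u (u * x - x * u)) : Commute u x := by
  have h1 : star u * u = 1 := Unitary.star_mul_self_of_mem hu
  have h2 : u * star u = 1 := Unitary.mul_star_self_of_mem hu
  set y := (u * x - x * u) * star u with hy
  have hyu : y * u = u * x - x * u := by rw [hy, mul_assoc, h1, mul_one]
  have hcy : u * y = y * u := by
    rw [hyu, hy, ← mul_assoc, h.eq, mul_assoc, h2, mul_one]
  -- Conjugation by `u ^ k` shifts `x` by `k • y` but preserves its norm, so `y` must vanish.
  have hpow : ∀ k : ℕ, u ^ k * x = (x + k • y) * u ^ k := by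
    intro k
    induction k with
    | zero => simp
    | succ k ih =>
      calc u ^ (k + 1) * x = u * (u ^ k * x) := by rw [pow_succ', mul_assoc]
        _ = (u * x + k • (u * y)) * u ^ k := by
          rw [ih, ← mul_assoc, mul_add, mul_smul_comm]
        _ = ((x + (k + 1) • y) * u) * u ^ k := by
          congr 1
          rw [hcy, add_mul, smul_mul_assoc, add_smul, one_smul, hyu]
          abel
        _ = (x + (k + 1) • y) * u ^ (k + 1) := by rw [mul_assoc, pow_succ']
  have hbound : ∀ k : ℕ, k * ‖y‖ ≤ 2 * ‖x‖ := by
    intro k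
    have hk : u ^ k ∈ unitary B := pow_mem hu k
    have e : ‖x + k • y‖ = ‖x‖ := by
      rw [← CStarRing.norm_mul_mem_unitary _ hk, ← hpow k, CStarRing.norm_mem_unitary_mul _ hk]
    calc (k : ℝ) * ‖y‖ = ‖(x + k • y) - x‖ := by
          rw [add_sub_cancel_left, ← Nat.cast_smul_eq_nsmul ℝ, norm_smul]; simp
      _ ≤ ‖x + k • y‖ + ‖x‖ := norm_sub_le _ _
      _ = 2 * ‖x‖ := by rw [e]; ring
  have hy0 : y = 0 := by
    by_contra hne
    obtain ⟨k, hk⟩ := exists_nat_gt (2 * ‖x‖ / ‖y‖)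
    rw [div_lt_iff₀ (norm_pos_iff.2 hne)] at hk
    exact absurd (hbound k) (not_le.2 hk)
  rw [hy0, zero_mul] at hyu
  exact (sub_eq_zero.1 hyu.symm)

/-- An element commuting with all unitaries of a closed star subalgebra commutes with the whole
subalgebra. -/
theorem commute_of_forall_unitary {S : StarSubalgebra ℂ B} (hS : IsClosed (S : Set B)) {a : B}
    (h : ∀ u ∈ S, u ∈ unitary B → Commute a u) {s : B} (hs : s ∈ S) : Commute a s := by
  have := hS
  obtain ⟨u, k, hsum, -⟩ := CStarAlgebra.exists_sum_four_unitary (⟨s, hs⟩ : S)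
  have hsum' : s = ∑ i, k i • ((u i : S) : B) := by
    have := congrArg (Subtype.val) hsum
    simpa using this
  rw [hsum']
  refine Commute.sum_right _ _ _ fun i _ => Commute.smul_right (h _ (u i : S).2 ?_) _
  have hui := (u i).2
  rw [Unitary.mem_iff] at hui ⊢
  exact ⟨congrArg Subtype.val hui.1, congrArg Subtype.val hui.2⟩

theorem isClosed_starSubalgebra_centralizer (s : Set B) :
    IsClosed (StarSubalgebra.centralizer ℂ s : Set B) := by
  rw [StarSubalgebra.coe_centralizer]
  exact Set.isClosed_centralizer _

/-- An element `c` with `[[c, e], e] ∈ span {e, 1}` commutes with the idempotent `e`. -/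
theorem commute_of_isIdempotentElem {R : Type*} [Ring R] [Algebra ℂ R] {c e : R}
    (he : IsIdempotentElem e) {a b : ℂ}
    (h : c * (e * e) + e * e * c - (2 : ℂ) • (e * c * e) = a • e + b • (1 : R)) :
    Commute c e := by
  have he' : e * e = e := he
  have e1 : ∀ x : R, e * (e * x) = e * x := fun x => by rw [← mul_assoc, he']
  rw [he'] at h
  -- The double commutator has zero compressions to `e` and to `1 - e`, so its right-hand side
  -- vanishes.
  have h1 : (a + b) • e = 0 := by
    have := congrArg (fun x => e * x * e) h
    simp only [mul_add, add_mul, mul_sub, sub_mul, mul_smul_comm, smul_mul_assoc, mul_assoc, he',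
      e1, mul_one] at this
    linear_combination (norm := module) -this
  have h2 : b • (1 - e) = 0 := by
    have := congrArg (fun x => (1 - e) * x * (1 - e)) h
    simp only [mul_add, add_mul, mul_sub, sub_mul, mul_smul_comm, smul_mul_assoc, mul_assoc, he',
      e1, mul_one, one_mul] at this
    linear_combination (norm := module) -this
  have h3 : c * e + e * c - (2 : ℂ) • (e * c * e) = 0 := by
    linear_combination (norm := module) h + h1 + h2
  have h4 : e * c = e * c * e := by
    have := congrArg (fun x => e * x) h3
    simp only [mul_add, mul_sub, mul_smul_comm, mul_assoc, e1, mul_zero] at this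
    rw [mul_assoc]
    linear_combination (norm := module) this
  have h5 : c * e = e * c * e := by
    linear_combination (norm := module) h3 - h4
  exact h5.trans h4.symm

/-- Let `P` be a commuting family of projections of a C⋆-algebra and `𝒜` the algebra of all `A` with
`A p = p A p` for `p ∈ P`. An element `c` of `𝒜` with `[[c, A], A] ∈ span {A, 1}` for all `A ∈ 𝒜`
is central in `𝒜`. -/
theorem commute_of_double_commutator_mem_span {P : Set B} {𝒜 : Subalgebra ℂ B}
    (hsa : ∀ p ∈ P, star p = p) (hid : ∀ p ∈ P, p * p = p)
    (hcomm : ∀ p ∈ P, ∀ q ∈ P, Commute p q)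
    (h𝒜 : ∀ A, A ∈ 𝒜 ↔ ∀ p ∈ P, A * p = p * A * p) {c : B}
    (h : ∀ A ∈ 𝒜, ∃ a b : ℂ,
      c * (A * A) + A * A * c - (2 : ℂ) • (A * c * A) = a • A + b • (1 : B))
    {A : B} (hA : A ∈ 𝒜) : Commute c A := by
  have mem_N : ∀ x, x ∈ StarSubalgebra.centralizer ℂ P ↔ ∀ p ∈ P, p * x = x * p := by
    intro x
    rw [StarSubalgebra.mem_centralizer_iff]
    exact forall₂_congr fun p hp => by rw [hsa p hp, and_self]
  have N_le : ∀ x ∈ StarSubalgebra.centralizer ℂ P, x ∈ 𝒜 := by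
    intro x hx
    rw [h𝒜]
    intro p hp
    rw [(mem_N x).1 hx p hp, mul_assoc, hid p hp]
  have P_le : ∀ p ∈ P, p ∈ StarSubalgebra.centralizer ℂ P := fun p hp =>
    (mem_N p).2 fun q hq => hcomm q hq p hp
  have hcN : ∀ x ∈ StarSubalgebra.centralizer ℂ P, Commute c x := by
    refine fun x hx => commute_of_forall_unitary (isClosed_starSubalgebra_centralizer P) ?_ hx
    intro u huN hu
    obtain ⟨a, b, hab⟩ := h u (N_le u huN)
    -- [u, [u, c]] lies in span {u, 1}, hence commutes with `u`; peel off one commutator at a time.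
    refine (commute_of_commute_commutator hu (commute_of_commute_commutator hu ?_)).symm
    have : u * (u * c - c * u) - (u * c - c * u) * u = a • u + b • (1 : B) := by
      rw [← hab]
      simp only [mul_sub, sub_mul, mul_assoc]
      module
    rw [this]
    exact ((Commute.refl u).smul_right a).add_right ((Commute.one_right u).smul_right b)
  have hcP : ∀ p ∈ P, Commute c p := fun p hp => hcN p (P_le p hp)
  have hcA : ∀ p ∈ P, Commute c (p * A - A * p) := by
    intro p hp
    have hAp := (h𝒜 A).1 hA p hp
    have hp𝒜 := N_le p (P_le p hp)
    -- As Ap = pAp, the commutator is the corner pA(1 - p), and adding `p` makes it an idempotent.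
    have hmem : p + (p * A - A * p) ∈ 𝒜 :=
      add_mem hp𝒜 (sub_mem (mul_mem hp𝒜 hA) (mul_mem hA hp𝒜))
    obtain ⟨a, b, hab⟩ := h _ hmem
    have hidem : IsIdempotentElem (p + (p * A - A * p)) := by
      have hp2 : ∀ x, p * (p * x) = p * x := fun x => by rw [← mul_assoc, hid p hp]
      have hAp2 : p * (A * p) = A * p := by rw [← mul_assoc, ← hAp]
      have hAp3 : ∀ x, p * (A * (p * x)) = A * (p * x) := fun x => by
        rw [← mul_assoc, ← mul_assoc, ← hAp, mul_assoc]
      have hAp4 : p * (A * (A * p)) = A * (A * p) := by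
        rw [← mul_assoc A A p, ← mul_assoc, ← (h𝒜 (A * A)).1 (mul_mem hA hA) p hp]
      simp only [IsIdempotentElem, mul_add, add_mul, mul_sub, sub_mul, mul_assoc, hid p hp, hp2,
        hAp2, hAp3, hAp4]
      abel
    have := (commute_of_isIdempotentElem hidem hab).sub_right (hcP p hp)
    rwa [add_sub_cancel_left] at this
  have hcc : c ∈ StarSubalgebra.centralizer ℂ P := (mem_N c).2 fun p hp => (hcP p hp).symm.eq
  have hnormal : IsStarNormal c := ⟨(hcN _ (star_mem hcc)).symm⟩
  -- Fuglede's theorem for the normal element `c` places it in its own star bicommutant.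
  have hcM : c ∈ StarSubalgebra.centralizer ℂ {x | Commute c x} := by
    rw [StarSubalgebra.mem_centralizer_iff]
    intro x hx
    refine ⟨hx.symm.eq, ?_⟩
    have h1 : Commute (star c) x := hnormal.commute_star_left hx
    simpa using (h1.star_star).symm.eq
  refine (commute_of_forall_unitary
    (isClosed_starSubalgebra_centralizer {x | Commute c x}) ?_ hcM).symm
  intro u huM hu
  rw [StarSubalgebra.mem_centralizer_iff] at huM
  refine (commute_of_commute_commutator hu ?_).symm
  -- Since `u` commutes with `p` and [p, A], it follows that [p, [u, A]] = [u, [p, A]] = 0.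
  have hN : u * A - A * u ∈ StarSubalgebra.centralizer ℂ P := by
    rw [mem_N]
    intro p hp
    have h1 := (huM p (hcP p hp)).1
    have h2 := (huM _ (hcA p hp)).1
    have h3 : p * (u * A) = u * (p * A) := by rw [← mul_assoc, h1, mul_assoc]
    have h4 : A * u * p = A * p * u := by rw [mul_assoc, ← h1, mul_assoc]
    rw [mul_sub, sub_mul] at h2
    rw [mul_sub, sub_mul, h3, h4, ← sub_eq_zero, ← mul_assoc p A u]
    rw [← sub_eq_zero] at h2
    rw [← neg_eq_zero, ← h2]
    noncomm_ring
  exact (huM _ (hcN _ hN)).1.symm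

end CStar

section JordanCentralizers

variable {R : Type*} [Ring R] [Algebra ℂ R] {m n l : ℕ} {δ : R →ₗ[ℂ] R}

theorem IsWeakJordanCentralizer.exists_eq_add_smul_one (hδ : IsWeakJordanCentralizer m n l δ)
    (A : R) : ∃ f : ℂ, ((m : ℂ) + n + 2 * l) • δ A =
      ((m : ℂ) + l) • (δ 1 * A) + ((n : ℂ) + l) • (A * δ 1) + f • (1 : R) := by
  obtain ⟨a, ha⟩ := hδ.2 A
  obtain ⟨b, hb⟩ := hδ.2 (A + 1)
  refine ⟨b - a, ?_⟩
  simp only [← Nat.cast_smul_eq_nsmul ℂ, Nat.cast_add, mul_add, add_mul, mul_one, one_mul,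
    map_add] at ha hb
  linear_combination (norm := module) hb - ha

/-- Multiply the defining identity by m + n + 2l and eliminate δ(A) and δ(A²) by the linear formula.
The coefficient of A is kept explicit because, once δ(1) is central, it decides whether f vanishes.
-/
theorem IsWeakJordanCentralizer.exists_double_commutator (hδ : IsWeakJordanCentralizer m n l δ)
    {A : R} {f : ℂ} (hf : ((m : ℂ) + n + 2 * l) • δ A =
      ((m : ℂ) + l) • (δ 1 * A) + ((n : ℂ) + l) • (A * δ 1) + f • (1 : R)) :
    ∃ b : ℂ, (((m : ℂ) + l) * (n + l)) •
      (δ 1 * (A * A) + A * A * δ 1 - (2 : ℂ) • (A * δ 1 * A)) =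
        ((m + n) * f) • A + b • (1 : R) := by
  obtain ⟨a, ha⟩ := hδ.2 A
  obtain ⟨g, hg⟩ := hδ.exists_eq_add_smul_one (A * A)
  have hl := congrArg (A * ·) hf
  have hr := congrArg (· * A) hf
  simp only [← Nat.cast_smul_eq_nsmul ℂ, Nat.cast_add] at ha
  simp only [mul_add, add_mul, mul_one, one_mul, mul_smul_comm, smul_mul_assoc, mul_assoc]
    at hl hr hg ha ⊢
  refine ⟨((m : ℂ) + n + 2 * l) * a - (m + n + l) * g, ?_⟩
  linear_combination (norm := module) ((m : ℂ) + n + 2 * l) • ha - ((m : ℂ) + n + l) • hg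
    + (m : ℂ) • hr + (n : ℂ) • hl

theorem IsWeakJordanCentralizer.exists_double_commutator_mem_span (hml : 1 ≤ m + l)
    (hnl : 1 ≤ n + l) (hδ : IsWeakJordanCentralizer m n l δ) (A : R) : ∃ a b : ℂ,
      δ 1 * (A * A) + A * A * δ 1 - (2 : ℂ) • (A * δ 1 * A) = a • A + b • (1 : R) := by
  obtain ⟨f, hf⟩ := hδ.exists_eq_add_smul_one A
  obtain ⟨b, hb⟩ := hδ.exists_double_commutator hf
  have ht : ((m : ℂ) + l) * (n + l) ≠ 0 := by
    have : (m + l) * (n + l) ≠ 0 := by positivity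
    exact_mod_cast this
  refine ⟨(((m : ℂ) + l) * (n + l))⁻¹ * ((m + n) * f), (((m : ℂ) + l) * (n + l))⁻¹ * b, ?_⟩
  rw [mul_smul _ ((m + n) * f) A, mul_smul _ b, ← smul_add, ← hb, inv_smul_smul₀ ht]

/-- A weak Jordan centralizer `δ` with `δ(1)` central is a centralizer. -/
theorem IsWeakJordanCentralizer.isCentralizer_of_commute (hml : 1 ≤ m + l)
    (hδ : IsWeakJordanCentralizer m n l δ) (hmn : m + n ≠ 0 ∨ IsJordanCentralizer m n l δ)
    (hc : ∀ A, Commute (δ 1) A) : IsCentralizer δ := by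
  have key : ∀ A, δ A = δ 1 * A := by
    intro A
    by_cases h0 : m + n = 0
    · obtain ⟨-, hJ⟩ := hmn.resolve_left (not_not.2 h0)
      obtain ⟨rfl, rfl⟩ : m = 0 ∧ n = 0 := by omega
      have hl : (l : ℂ) ≠ 0 := by
        have : l ≠ 0 := by omega
        exact_mod_cast this
      have hsq : ∀ A, δ (A * A) = δ 1 * (A * A) := by
        intro A
        have := hJ A
        simp only [← Nat.cast_smul_eq_nsmul ℂ, zero_add, zero_smul, Nat.cast_zero] at this
        rw [smul_right_injective _ hl this, ← (hc A).eq, mul_assoc]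
      have h1 := hsq (A + 1)
      have h2 := hsq A
      simp only [mul_add, add_mul, mul_one, one_mul, map_add] at h1
      linear_combination (norm := module) (1 / 2 : ℂ) • (h1 - h2)
    · obtain ⟨f, hf⟩ := hδ.exists_eq_add_smul_one A
      obtain ⟨b, hb⟩ := hδ.exists_double_commutator hf
      have hs : (m : ℂ) + n + 2 * l ≠ 0 := by
        have : m + n + 2 * l ≠ 0 := by omega
        exact_mod_cast this
      have h0' : (m : ℂ) + n ≠ 0 := by exact_mod_cast h0
      have hAA : A * A * δ 1 = δ 1 * (A * A) := ((hc (A * A)).eq).symm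
      have hAc : A * δ 1 * A = δ 1 * (A * A) := by rw [← (hc A).eq, mul_assoc]
      rw [hAA, hAc] at hb
      -- Either `f = 0` and the linear formula gives the claim, or `A` is scalar. This needs m + n ≠
      -- 0; the case m = n = 0 was settled by polarizing squares.
      have hb' : ((m + n) * f) • A + b • (1 : R) = 0 := by
        rw [← hb]
        module
      by_cases hf0 : f = 0
      · rw [hf0, zero_smul, add_zero, ← (hc A).eq] at hf
        refine smul_right_injective _ hs ?_
        simp only
        rw [hf]
        module
      · have hA : A = (-(((m + n) * f)⁻¹ * b)) • (1 : R) := by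
          rw [neg_smul, mul_smul, ← smul_neg, ← eq_neg_of_add_eq_zero_left hb',
            inv_smul_smul₀ (mul_ne_zero h0' hf0)]
        rw [hA, map_smul, mul_smul_comm, mul_one]
  refine ⟨fun A B => ?_, fun A B => ?_⟩
  · rw [key, key A, mul_assoc]
  · rw [key, key B, ← mul_assoc, ← mul_assoc, (hc A).eq]

end JordanCentralizers

theorem mem_alg_iff {H : Type*} [NormedAddCommGroup H] [InnerProductSpace ℂ H] [CompleteSpace H]
    {L : Set (ClosedSubmodule ℂ H)} {A : H →L[ℂ] H} :
    A ∈ alg L ↔ ∀ p ∈ (fun E : ClosedSubmodule ℂ H => E.toSubmodule.starProjection) '' L,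
      A * p = p * A * p := by
  rw [Set.forall_mem_image]
  refine forall₂_congr fun E _ => ?_
  constructor
  · intro h
    ext x
    exact (Submodule.starProjection_eq_self_iff.2
      (h _ (Submodule.starProjection_apply_mem E.toSubmodule x))).symm
  · intro h x hx
    have hx' : E.toSubmodule.starProjection x = x := Submodule.starProjection_eq_self_iff.2 hx
    have : A (E.toSubmodule.starProjection x) = E.toSubmodule.starProjection
      (A (E.toSubmodule.starProjection x)) := DFunLike.congr_fun h x
    rw [hx'] at this
    exact Submodule.starProjection_eq_self_iff.1 this.symm

end CSL

theorem theorem2p11 {H : Type*} [NormedAddCommGroup H] [InnerProductSpace ℂ H] [CompleteSpace H]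
    [TopologicalSpace.SeparableSpace H]
    (L : Set (ClosedSubmodule ℂ H)) (hL : CSL.IsCSL L)
    (m n l : ℕ) (hml : 1 ≤ m + l) (hnl : 1 ≤ n + l)
    (δ : CSL.alg L →L[ℂ] CSL.alg L)
    (hδ : CSL.IsWeakJordanCentralizer m n l (δ : CSL.alg L →ₗ[ℂ] CSL.alg L))
    (hmn : m + n ≠ 0 ∨ CSL.IsJordanCentralizer m n l (δ : CSL.alg L →ₗ[ℂ] CSL.alg L)) :
    CSL.IsCentralizer (δ : CSL.alg L →ₗ[ℂ] CSL.alg L) := by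
  have hc : ∀ A ∈ CSL.alg L, Commute ((δ 1 : CSL.alg L) : H →L[ℂ] H) A := by
    intro A hA
    refine CSL.commute_of_double_commutator_mem_span
      (P := (fun E : ClosedSubmodule ℂ H => E.toSubmodule.starProjection) '' L) (𝒜 := CSL.alg L)
      ?_ ?_ ?_ (fun _ => CSL.mem_alg_iff) ?_ hA
    · rintro _ ⟨E, -, rfl⟩
      exact isSelfAdjoint_starProjection E.toSubmodule
    · rintro _ ⟨E, -, rfl⟩
      exact E.toSubmodule.isIdempotentElem_starProjection
    · rintro _ ⟨E, hE, rfl⟩ _ ⟨F, hF, rfl⟩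
      exact hL.commute E hE F hF
    · intro X hX
      obtain ⟨a, b, hab⟩ := hδ.exists_double_commutator_mem_span hml hnl ⟨X, hX⟩
      exact ⟨a, b, congrArg Subtype.val hab⟩
  exact hδ.isCentralizer_of_commute hml hmn fun A => Subtype.ext (hc A A.2).eq
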